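/- In the local model there are $n$ users, the vertices of an $n$-vertex graph $G=(V,E)$, $n\ge 1$, and a server. The vertex set is public, and the private data of a user $v$ is its set of neighbors $N_v$. In every round each user sends a message to the server, which depends on $v$, $N_v$, its local memory, the transcript of the earlier rounds and fresh independent randomness, and may update its local memory. The server then either broadcasts a message (a function of the transcript, of the messages of this round and of fresh independent randomness) and starts the next round, or ends the interaction with an output. A mechanism is memoryless if no user ever changes its local memory. It is $\varepsilon$-edge differentially private if for all graphs $G,G'$ on $V$ that differ in at most one edge and all measurable sets $Y$ of transcripts (including the output), $\Pr[\text{transcript on }G\in Y]\le e^{\varepsilon}\Pr[\text{transcript on }G'\in Y]$. The coreness $k(v)$ of $v$ in $G$ is the largest $k$ such that $v$ lies in a subgraph of $G$ all of whose vertices have degree at least $k$ in it. **Theorem.** 1. There are constants $C(c)$, $c>0$, depending only on $c$, such that the following holds. For every $\varepsilon>0$ and every nonempty finite vertex set $V$, $|V|=n$, there is a memoryless local $\varepsilon$-edge differentially private mechanism $\mathcal M$, not depending on $c$, that runs for at most $n$ rounds in any execution, and for every graph $G$ on $V$ and every $c>0$, with probability at least $1-n^{-c}$, $\mathcal M$ returns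 estimates $\tilde k(v)$ such that for all $v\in V$ simultaneously $$k(v)-\alpha\le\tilde k(v)\le k(v)+\alpha,\qquad \alpha=C(c)\,\varepsilon^{-1}\log^2 n .$$ 2. If users may have persistent local memory, the same holds (with a possibly different mechanism, not necessarily memoryless, and possibly different constants $C(c)$) with $$\alpha=C(c)\,\varepsilon^{-1}\log n\,\log\max\{\Delta,2\},$$ where $\Delta$ is the maximum degree of $G$. The mechanism does not know $\Delta$. -/

import Mathlib

open MeasureTheory

universe u

namespace LocalDP

/-! ### Coreness -/

/-- The set of all `k` such that `v` belongs to a subgraph of `G` all of whose vertices have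
degree at least `k` inside that subgraph. -/
def corenessSet {V : Type u} (G : SimpleGraph V) (v : V) : Set ℕ :=
  {k | ∃ H : G.Subgraph, v ∈ H.verts ∧ ∀ w ∈ H.verts, k ≤ (H.neighborSet w).ncard}

/-- The coreness of `v` in `G`: the largest `k` such that `v` belongs to a subgraph of `G` in
which every vertex has degree at least `k`. -/
noncomputable def coreness {V : Type u} (G : SimpleGraph V) (v : V) : ℕ :=
  sSup (corenessSet G v)

/-- On a finite graph the supremum in the definition of the coreness is a maximum. -/
theorem coreness_isGreatest {V : Type u} [Finite V] (G : SimpleGraph V) (v : V) :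
    IsGreatest (corenessSet G v) (coreness G v) := by
  have hne : (corenessSet G v).Nonempty :=
    ⟨0, ⊤, by simp, fun w _ => Nat.zero_le _⟩
  have hbdd : BddAbove (corenessSet G v) := by
    refine ⟨Nat.card V, ?_⟩
    rintro k ⟨H, hv, hH⟩
    exact (hH v hv).trans (Set.ncard_le_card _)
  exact ⟨Nat.sSup_mem hne hbdd, fun k hk => le_csSup hbdd hk⟩

/-- Two graphs on the same vertex set are neighboring if they differ in at most one edge. -/
def Neighboring {V : Type u} (G G' : SimpleGraph V) : Prop :=
  (symmDiff G.edgeSet G'.edgeSet).Subsingleton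

/-! ### The local model -/

/-- What is communicated in one round: the message of every user to the server, and the reaction
of the server, which is either a message broadcast to all users (`Sum.inl`), or the end of the
interaction together with an output vector (`Sum.inr`). -/
abbrev RoundRecord (V : Type u) (Msg Bcast : Type) : Type u :=
  (V → Msg) × (Bcast ⊕ (V → ℝ))

/-- A (partial or complete) transcript. Its entry at `t` is the record of round `t`
(rounds are numbered `0, 1, 2, …`), or `Sum.inl ()` if round `t` has not taken place. -/
abbrev Transcript (V : Type u) (Msg Bcast : Type) : Type u :=
  ℕ → Unit ⊕ RoundRecord V Msg Bcast

/-- A transcript has ended if in some round the server ended the interaction with an output. -/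
def Ended {V : Type u} {Msg Bcast : Type} (τ : Transcript V Msg Bcast) : Prop :=
  ∃ (t : ℕ) (msgs : V → Msg) (out : V → ℝ), τ t = Sum.inr (msgs, Sum.inr out)

/-- A local mechanism whose users are the vertices `v : V`, returning a real number for each user.
`Msg`, `Bcast`, `Mem`, `Seed` are the sets of user messages, of server broadcasts, of states of the
local memory of a user, and of values of the fresh local randomness used in one round. -/
structure LocalMechanism (V : Type u) where
  Msg : Type
  Bcast : Type
  Mem : Type
  Seed : Type
  [measMsg : MeasurableSpace Msg]
  [borelMsg : StandardBorelSpace Msg]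
  [measBcast : MeasurableSpace Bcast]
  [borelBcast : StandardBorelSpace Bcast]
  [measMem : MeasurableSpace Mem]
  [measSeed : MeasurableSpace Seed]
  /-- The distribution of the fresh randomness of one party in one round. -/
  seedLaw : Measure Seed
  [probSeed : IsProbabilityMeasure seedLaw]
  /-- The initial state of the local memory of each user (it carries no private data). -/
  mem₀ : Mem
  /-- `user t v N τ m γ`: in round `t`, user `v` with private data `N` (its set of neighbors), after
  the transcript `τ` of the earlier rounds, with memory state `m` and fresh randomness `γ`, sends
  the first component to the server and sets its local memory to the second component. -/
  user : ℕ → V → Set V → Transcript V Msg Bcast → Mem → Seed → Msg × Mem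
  /-- `server t τ msgs γ`: the reaction of the server in round `t` after the transcript `τ` of the
  earlier rounds, on the user messages `msgs` of this round, with fresh randomness `γ`. -/
  server : ℕ → Transcript V Msg Bcast → (V → Msg) → Seed → Bcast ⊕ (V → ℝ)
  measurable_user : ∀ (t : ℕ) (v : V) (N : Set V),
    Measurable (fun p : Transcript V Msg Bcast × Mem × Seed => user t v N p.1 p.2.1 p.2.2)
  measurable_server : ∀ t : ℕ,
    Measurable (fun p : Transcript V Msg Bcast × (V → Msg) × Seed => server t p.1 p.2.1 p.2.2)

attribute [instance] LocalMechanism.measMsg LocalMechanism.borelMsg LocalMechanism.measBcast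
  LocalMechanism.borelBcast LocalMechanism.measMem LocalMechanism.measSeed LocalMechanism.probSeed

namespace LocalMechanism

variable {V : Type u}

/-- The fresh randomness of a whole execution: `ω t (some v)` is used by user `v` in round `t`, and
`ω t none` is used by the server in round `t`. -/
abbrev Randomness (M : LocalMechanism V) : Type u :=
  ℕ → Option V → M.Seed

/-- All parties in all rounds use independent fresh randomness. -/
noncomputable def randomnessLaw [Fintype V] (M : LocalMechanism V) : Measure M.Randomness :=
  Measure.infinitePi (fun _ : ℕ => Measure.pi (fun _ : Option V => M.seedLaw))

/-- The state of an execution between two rounds: the transcript so far, and the content of the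
local memory of every user. -/
abbrev State (M : LocalMechanism V) : Type u :=
  Transcript V M.Msg M.Bcast × (V → M.Mem)

open Classical in
/-- Round `t` of the execution on input graph `G`, with fresh randomness `γ`. Nothing happens if
the interaction has already ended. -/
noncomputable def step (M : LocalMechanism V) (G : SimpleGraph V) (t : ℕ)
    (γ : Option V → M.Seed) (s : M.State) : M.State :=
  if Ended s.1 then s
  else
    let reply : V → M.Msg × M.Mem := fun v =>
      M.user t v (G.neighborSet v) s.1 (s.2 v) (γ (some v))
    let msgs : V → M.Msg := fun v => (reply v).1
    (Function.update s.1 t (Sum.inr (msgs, M.server t s.1 msgs (γ none))), fun v => (reply v).2)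

/-- The state of the execution on input graph `G` with randomness `ω` before round `t`. -/
noncomputable def run (M : LocalMechanism V) (G : SimpleGraph V) (ω : M.Randomness) :
    ℕ → M.State
  | 0 => (fun _ => Sum.inl (), fun _ => M.mem₀)
  | t + 1 => M.step G t (ω t) (run M G ω t)

/-- The complete transcript of the execution on input graph `G` with randomness `ω`. -/
noncomputable def transcript (M : LocalMechanism V) (G : SimpleGraph V) (ω : M.Randomness) :
    Transcript V M.Msg M.Bcast :=
  fun t => (M.run G ω (t + 1)).1 t

/-- The execution on input graph `G` with randomness `ω` ends with the output vector `est`. -/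
def Returns (M : LocalMechanism V) (G : SimpleGraph V) (ω : M.Randomness) (est : V → ℝ) : Prop :=
  ∃ (t : ℕ) (msgs : V → M.Msg), M.transcript G ω t = Sum.inr (msgs, Sum.inr est)

/-- A mechanism is memoryless if no user ever writes to its local memory. -/
def Memoryless (M : LocalMechanism V) : Prop :=
  ∀ (t : ℕ) (v : V) (N : Set V) (τ : Transcript V M.Msg M.Bcast) (m : M.Mem) (γ : M.Seed),
    (M.user t v N τ m γ).2 = m

/-- `ε`-edge differential privacy: the transcript (including the output of the server) is
`ε`-differentially private on graphs that differ in at most one edge. -/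
def EdgePrivate [Fintype V] (M : LocalMechanism V) (ε : ℝ) : Prop :=
  ∀ G G' : SimpleGraph V, Neighboring G G' →
    ∀ Y : Set (Transcript V M.Msg M.Bcast), MeasurableSet Y →
      M.randomnessLaw {ω | M.transcript G ω ∈ Y} ≤
        ENNReal.ofReal (Real.exp ε) * M.randomnessLaw {ω | M.transcript G' ω ∈ Y}

/-- Every execution has ended after at most `n` rounds. -/
def RoundsAtMost (M : LocalMechanism V) (n : ℕ) : Prop :=
  ∀ (G : SimpleGraph V) (ω : M.Randomness), Ended (M.run G ω n).1

/-- The execution on `G` with randomness `ω` returns an estimate of the coreness of each vertex,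
and all these estimates have additive error at most `α`. -/
def EstimatesWithin (M : LocalMechanism V) (G : SimpleGraph V) (ω : M.Randomness) (α : ℝ) :
    Prop :=
  ∃ est : V → ℝ, M.Returns G ω est ∧
    ∀ v : V, (coreness G v : ℝ) - α ≤ est v ∧ est v ≤ (coreness G v : ℝ) + α

end LocalMechanism

end LocalDP

namespace LocalDP

/-! ### Two-sided geometric noise -/

/-! Both mechanisms peel the graph: a level starts at 0, every round removes the remaining vertices
whose noisy degree among the remaining ones is at most the level, and the level rises when nothing
is removed. The estimate of a vertex is the level at its removal. If all noise is at most `A`, then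
a rise to level `j + 1` exhibits a subgraph of minimum degree at least `j + 1 - A`, while no vertex
of a subgraph of minimum degree `k` is removed as long as the level is below `k - A`. So the error
is at most `A` (`peelEstimate_le_coreness_add`, `coreness_le_peelEstimate_add`); `n` rounds suffice
because each removes a vertex or raises the level.

Privacy is a change of variables: for neighboring graphs the noise is shifted by an amount
determined by the messages so that the messages stay the same, at cost `a` per unit of shift
(`edgePrivate_integerMechanism`). Only the two endpoints of the edge need a shift.

Without memory, users publish noisy degree increments along a dyadic tree of rounds. An edge affects
a logarithmic number of increments, and a degree is a sum of logarithmically many. With memory,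
users publish only whether they fall below the level, as in the sparse vector technique: one
persistent noise and one fresh noise, total shift 3 per endpoint. This gives error of order `ε⁻¹ log
n`, within the required bound. -/

theorem hasSum_pow_natAbs {s : ℝ} (h0 : 0 ≤ s) (h1 : s < 1) :
    HasSum (fun x : ℤ => s ^ x.natAbs) ((1 + s) / (1 - s)) := by
  have hg := hasSum_geometric_of_lt_one h0 h1
  have h := HasSum.of_nat_of_neg_add_one (f := fun x : ℤ => s ^ x.natAbs)
    (m := (1 - s)⁻¹) (m' := s * (1 - s)⁻¹) (by simpa using hg) (by
      have h2 := hg.mul_left s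
      refine h2.congr_fun ?_
      intro n
      have : (-((n : ℤ) + 1)).natAbs = n + 1 := by omega
      rw [this, pow_succ'])
  have e : (1 - s)⁻¹ + s * (1 - s)⁻¹ = (1 + s) / (1 - s) := by
    rw [div_eq_mul_inv]; ring
  rwa [e] at h

/-- The unnormalized mass `e^{-a|x|}` of the two-sided geometric distribution. -/
noncomputable def geometricWeight (a : ℝ) (x : ℤ) : ENNReal :=
  ENNReal.ofReal (Real.exp (-a) ^ x.natAbs)

theorem tsum_geometricWeight {a : ℝ} (ha : 0 < a) :
    ∑' x : ℤ, geometricWeight a x =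
      ENNReal.ofReal ((1 + Real.exp (-a)) / (1 - Real.exp (-a))) := by
  have h := hasSum_pow_natAbs (Real.exp_pos (-a)).le (Real.exp_lt_one_iff.2 (by linarith))
  rw [← h.tsum_eq, ENNReal.ofReal_tsum_of_nonneg (fun _ => by positivity) h.summable]
  rfl

theorem tsum_geometricWeight_ne_zero {a : ℝ} (ha : 0 < a) :
    ∑' x : ℤ, geometricWeight a x ≠ 0 := by
  have h1 := Real.exp_lt_one_iff.2 (show -a < 0 by linarith)
  have h0 := Real.exp_pos (-a)
  rw [tsum_geometricWeight ha, Ne, ENNReal.ofReal_eq_zero, not_le]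
  exact div_pos (by linarith) (by linarith)

/-- The two-sided geometric distribution, the mass of `x : ℤ` being proportional to `e^{-a|x|}`. -/
noncomputable def geometricNoise (a : ℝ) (ha : 0 < a) : PMF ℤ :=
  PMF.normalize (geometricWeight a) (tsum_geometricWeight_ne_zero ha)
    (by rw [tsum_geometricWeight ha]; exact ENNReal.ofReal_ne_top)

theorem geometricNoise_le {a : ℝ} (ha : 0 < a) (x y : ℤ) :
    geometricNoise a ha x ≤ ENNReal.ofReal (Real.exp (a * y.natAbs)) *
      geometricNoise a ha (x + y) := by
  simp only [geometricNoise, PMF.normalize_apply]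
  rw [← mul_assoc]
  gcongr
  unfold geometricWeight
  rw [← ENNReal.ofReal_mul (Real.exp_pos _).le]
  apply ENNReal.ofReal_le_ofReal
  rw [← Real.exp_nat_mul, ← Real.exp_nat_mul, ← Real.exp_add]
  apply Real.exp_le_exp.2
  have h : ((x + y).natAbs : ℝ) ≤ x.natAbs + y.natAbs := by
    exact_mod_cast Int.natAbs_add_le x y
  nlinarith

/-- The moment is a ratio of the normalizing sums for `a / 2` and `a`. With `s = e^{-a/2}` it equals
`(1 + s)² / (1 + s²) ≤ 2`. -/
theorem lintegral_exp_geometricNoise_le {a : ℝ} (ha : 0 < a) :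
    ∫⁻ x, ENNReal.ofReal (Real.exp (a / 2 * (x.natAbs : ℝ))) ∂(geometricNoise a ha).toMeasure
      ≤ 2 := by
  have hs : ∀ x : ℤ, ENNReal.ofReal (Real.exp (a / 2 * (x.natAbs : ℝ))) *
      geometricWeight a x = geometricWeight (a / 2) x := by
    intro x
    unfold geometricWeight
    rw [← ENNReal.ofReal_mul (Real.exp_pos _).le, ← Real.exp_nat_mul, ← Real.exp_nat_mul,
      ← Real.exp_add]
    congr 2; ring
  rw [lintegral_countable']
  simp only [PMF.toMeasure_apply_singleton _ _ (measurableSet_singleton _), geometricNoise,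
    PMF.normalize_apply, ← mul_assoc, hs]
  rw [ENNReal.tsum_mul_right, ← div_eq_mul_inv]
  apply ENNReal.div_le_of_le_mul
  rw [tsum_geometricWeight ha, tsum_geometricWeight (half_pos ha)]
  have e : Real.exp (-a) = Real.exp (-(a / 2)) ^ 2 := by
    rw [← Real.exp_nat_mul]; congr 1; push_cast; ring
  have h1 := Real.exp_lt_one_iff.2 (show -(a / 2) < 0 by linarith)
  have h0 := Real.exp_pos (-(a / 2))
  rw [e]
  generalize Real.exp (-(a / 2)) = s at *
  have : (2 : ENNReal) = ENNReal.ofReal 2 := by simp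
  rw [this, ← ENNReal.ofReal_mul (by norm_num)]
  apply ENNReal.ofReal_le_ofReal
  have hd : 1 - s ^ 2 = (1 - s) * (1 + s) := by ring
  rw [hd, div_le_iff₀ (by linarith)]
  have : 2 * ((1 + s ^ 2) / ((1 - s) * (1 + s))) * (1 - s) = 2 * (1 + s ^ 2) / (1 + s) := by
    have : 1 - s ≠ 0 := by linarith
    field_simp
  rw [this, le_div_iff₀ (by linarith)]
  nlinarith [sq_nonneg (1 - s)]

/-! ### Mechanisms with integer messages, a silent server and a fixed number of rounds -/

section IntegerMechanism

variable {V : Type u}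

/-- The user messages of the rounds before round `t`, extended by zero. -/
def history (t : ℕ) (τ : Transcript V ℤ Unit) : ℕ → V → ℤ :=
  fun s v => if s < t then Sum.elim (fun _ => 0) (fun r => r.1 v) (τ s) else 0

/-- The history takes values in a countable discrete space, since it consists of finitely many
integers; hence no condition on `f` is needed. -/
theorem measurable_comp_history [Finite V] {α β : Type*} [MeasurableSpace α] [Countable α]
    [MeasurableSingletonClass α] [MeasurableSpace β] (t : ℕ) (f : (ℕ → V → ℤ) → α → β) :
    Measurable (fun p : Transcript V ℤ Unit × α => f (history t p.1) p.2) := by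
  let r : Transcript V ℤ Unit → Fin t → V → ℤ :=
    fun τ s v => Sum.elim (fun _ => 0) (fun r => r.1 v) (τ s)
  let g : (Fin t → V → ℤ) × α → β :=
    fun p => f (fun s v => if h : s < t then p.1 ⟨s, h⟩ v else 0) p.2
  have hr : Measurable r := by
    refine measurable_pi_lambda _ fun s => measurable_pi_lambda _ fun v => ?_
    have h1 : Measurable (Sum.elim (fun _ => 0) (fun r => r.1 v) :
        Unit ⊕ RoundRecord V ℤ Unit → ℤ) :=
      Measurable.sumElim measurable_const ((measurable_pi_apply v).comp measurable_fst)
    exact h1.comp (measurable_pi_apply _)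
  have hg : Measurable g := Measurable.of_discrete
  have h := hg.comp ((hr.comp measurable_fst).prodMk measurable_snd)
  have e : (fun p : Transcript V ℤ Unit × α => f (history t p.1) p.2) =
      g ∘ fun p => ((r ∘ Prod.fst) p, p.2) := by
    funext p
    refine congrFun (congrArg f ?_) p.2
    funext s v
    by_cases hs : s < t <;> simp [history, hs, r]
  rwa [e]

/-- The mechanism with noise `geometricNoise a`, running for `n` rounds, in which users reply
according to `reply`, which sees the earlier messages, and the output is a function `out` of all
messages. -/
noncomputable def integerMechanism [Finite V] (n : ℕ) (a : ℝ) (ha : 0 < a)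
    (reply : ℕ → V → Set V → (ℕ → V → ℤ) → ℤ → ℤ → ℤ × ℤ) (out : (ℕ → V → ℤ) → V → ℝ) :
    LocalMechanism V where
  Msg := ℤ
  Bcast := Unit
  Mem := ℤ
  Seed := ℤ
  seedLaw := (geometricNoise a ha).toMeasure
  mem₀ := 0
  user t v N τ m γ := reply t v N (history t τ) m γ
  server t τ msgs _ :=
    if t + 1 < n then Sum.inl () else Sum.inr (out (Function.update (history t τ) t msgs))
  measurable_user t v N :=
    measurable_comp_history t (fun m (p : ℤ × ℤ) => reply t v N m p.1 p.2)
  measurable_server t := measurable_comp_history t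
    (fun m (p : (V → ℤ) × ℤ) => if t + 1 < n then (Sum.inl () : Unit ⊕ (V → ℝ))
      else Sum.inr (out (Function.update m t p.1)))

/-- The messages of the first `t` rounds (extended by zero) and the local memories after them, in
the execution of `integerMechanism` on `G` in which the users have noise `ω`. -/
def simulate (reply : ℕ → V → Set V → (ℕ → V → ℤ) → ℤ → ℤ → ℤ × ℤ) (G : SimpleGraph V)
    (ω : ℕ → V → ℤ) : ℕ → (ℕ → V → ℤ) × (V → ℤ)
  | 0 => (0, 0)
  | t + 1 =>
    (Function.update (simulate reply G ω t).1 t fun v =>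
      (reply t v (G.neighborSet v) (simulate reply G ω t).1 ((simulate reply G ω t).2 v)
        (ω t v)).1,
      fun v => (reply t v (G.neighborSet v) (simulate reply G ω t).1
        ((simulate reply G ω t).2 v) (ω t v)).2)

/-- The messages of the first `n` rounds. -/
abbrev messages (reply : ℕ → V → Set V → (ℕ → V → ℤ) → ℤ → ℤ → ℤ × ℤ) (G : SimpleGraph V)
    (ω : ℕ → V → ℤ) (n : ℕ) : ℕ → V → ℤ :=
  (simulate reply G ω n).1

variable {reply : ℕ → V → Set V → (ℕ → V → ℤ) → ℤ → ℤ → ℤ × ℤ} {G : SimpleGraph V}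

theorem messages_of_le {ω : ℕ → V → ℤ} {s t : ℕ} (h : t ≤ s) : messages reply G ω t s = 0 := by
  induction t with
  | zero => rfl
  | succ t ih =>
    rw [messages, simulate]
    dsimp only
    rw [Function.update_of_ne (by omega)]
    exact ih (by omega)

theorem messages_of_lt {ω : ℕ → V → ℤ} {s t T : ℕ} (h : s < t) (hT : t ≤ T) :
    messages reply G ω T s = messages reply G ω t s := by
  induction T, hT using Nat.le_induction with
  | base => rfl
  | succ T hT ih =>
    rw [messages, simulate]
    dsimp only
    rw [Function.update_of_ne (by omega)]
    exact ih

theorem messages_apply {ω : ℕ → V → ℤ} {t n : ℕ} (h : t < n) (v : V) :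
    messages reply G ω n t v =
      (reply t v (G.neighborSet v) (messages reply G ω t) ((simulate reply G ω t).2 v)
        (ω t v)).1 := by
  rw [messages_of_lt (Nat.lt_succ_self t) h, messages, simulate]
  dsimp only
  rw [Function.update_self]

theorem simulate_congr {ω ω' : ℕ → V → ℤ} {t : ℕ} (h : ∀ s < t, ω s = ω' s) :
    simulate reply G ω t = simulate reply G ω' t := by
  induction t with
  | zero => rfl
  | succ t ih => rw [simulate, simulate, ih fun s hs => h s (by omega), h t (by omega)]

/-- The transcript in which the users sent the messages `m` in the first `t` of `n` rounds. -/
def encodeTranscript (n : ℕ) (out : (ℕ → V → ℤ) → V → ℝ) (t : ℕ) (m : ℕ → V → ℤ) :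
    Transcript V ℤ Unit :=
  fun s => if s < t then Sum.inr (m s, if s + 1 < n then Sum.inl () else Sum.inr (out m))
    else Sum.inl ()

theorem history_encodeTranscript (n : ℕ) (out : (ℕ → V → ℤ) → V → ℝ) (t : ℕ) (ω : ℕ → V → ℤ) :
    history t (encodeTranscript n out t (messages reply G ω t)) = messages reply G ω t := by
  funext s v
  unfold history encodeTranscript
  by_cases h : s < t
  · simp [h]
  · simp [h, messages_of_le (not_lt.1 h)]

theorem not_ended_encodeTranscript {n t : ℕ} (h : t < n) (out : (ℕ → V → ℤ) → V → ℝ)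
    (m : ℕ → V → ℤ) : ¬ Ended (encodeTranscript n out t m) := by
  rintro ⟨s, msgs, o, hs⟩
  unfold encodeTranscript at hs
  split_ifs at hs with h1 h2
  · simp at hs
  · omega

theorem ended_encodeTranscript {n : ℕ} (h : 0 < n) (out : (ℕ → V → ℤ) → V → ℝ)
    (m : ℕ → V → ℤ) : Ended (encodeTranscript n out n m) :=
  ⟨n - 1, m (n - 1), out m, by
    unfold encodeTranscript
    rw [if_pos (by omega), if_neg (by omega)]⟩

/-- The part of the randomness that belongs to the users. -/
def userNoise (ω : ℕ → Option V → ℤ) : ℕ → V → ℤ :=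
  fun t v => ω t (some v)

theorem LocalMechanism.run_succ (M : LocalMechanism V) (G : SimpleGraph V) (ω : M.Randomness)
    (t : ℕ) : M.run G ω (t + 1) = M.step G t (ω t) (M.run G ω t) :=
  rfl

variable [Finite V] {n : ℕ} {a : ℝ} {ha : 0 < a} {out : (ℕ → V → ℤ) → V → ℝ}

theorem run_integerMechanism (ω : (integerMechanism n a ha reply out).Randomness) {t : ℕ}
    (ht : t ≤ n) :
    (integerMechanism n a ha reply out).run G ω t =
      (encodeTranscript n out t (messages reply G (userNoise ω) t),
        (simulate reply G (userNoise ω) t).2) := by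
  induction t with
  | zero =>
    refine Prod.ext ?_ rfl
    funext s
    rfl
  | succ t ih =>
    rw [LocalMechanism.run_succ, ih (by omega)]
    refine (if_neg (not_ended_encodeTranscript (by omega) _ _)).trans ?_
    simp only [integerMechanism, history_encodeTranscript]
    refine Prod.ext ?_ rfl
    funext s
    dsimp only
    rcases lt_trichotomy s t with h | rfl | h
    · rw [Function.update_of_ne (by omega)]
      simp only [encodeTranscript, if_pos h, if_pos (show s < t + 1 by omega),
        if_pos (show s + 1 < n by omega)]
      rw [messages_of_lt h (Nat.le_succ t)]
    · rw [Function.update_self]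
      simp only [encodeTranscript, if_pos (Nat.lt_succ_self s)]
      exact (congrArg (fun x => (Sum.inr (x, _) : Unit ⊕ RoundRecord V ℤ Unit))
        (Function.update_self (β := fun _ => V → ℤ) s _ _).symm)
    · rw [Function.update_of_ne (by omega)]
      simp only [encodeTranscript, if_neg (show ¬ s < t by omega),
        if_neg (show ¬ s < t + 1 by omega)]

theorem run_integerMechanism_of_le (hn : 0 < n)
    (ω : (integerMechanism n a ha reply out).Randomness) {t : ℕ} (ht : n ≤ t) :
    (integerMechanism n a ha reply out).run G ω t =
      (integerMechanism n a ha reply out).run G ω n := by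
  induction t, ht using Nat.le_induction with
  | base => rfl
  | succ t _ ih =>
    rw [LocalMechanism.run_succ, ih]
    refine if_pos ?_
    rw [run_integerMechanism ω le_rfl]
    exact ended_encodeTranscript hn _ _

theorem transcript_integerMechanism (hn : 0 < n)
    (ω : (integerMechanism n a ha reply out).Randomness) :
    (integerMechanism n a ha reply out).transcript G ω =
      encodeTranscript n out n (messages reply G (userNoise ω) n) := by
  funext s
  rw [LocalMechanism.transcript]
  by_cases h : s + 1 ≤ n
  · rw [run_integerMechanism ω h]
    simp only [encodeTranscript, if_pos (Nat.lt_succ_self s), if_pos (show s < n by omega)]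
    rw [messages_of_lt (Nat.lt_succ_self s) h]
    by_cases h' : s + 1 < n
    · simp only [if_pos h']
      rfl
    · obtain rfl : n = s + 1 := by omega
      rfl
  · rw [run_integerMechanism_of_le hn ω (by omega), run_integerMechanism ω le_rfl]

theorem roundsAtMost_integerMechanism (hn : 0 < n) :
    (integerMechanism n a ha reply out).RoundsAtMost n := by
  intro G ω
  rw [run_integerMechanism ω le_rfl]
  exact ended_encodeTranscript hn _ _

theorem returns_integerMechanism (hn : 0 < n) (ω : (integerMechanism n a ha reply out).Randomness) :
    (integerMechanism n a ha reply out).Returns G ω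
      (out (messages reply G (userNoise ω) n)) := by
  refine ⟨n - 1, messages reply G (userNoise ω) n (n - 1), ?_⟩
  rw [transcript_integerMechanism hn ω, encodeTranscript, if_pos (by omega), if_neg (by omega)]
  rfl

end IntegerMechanism

/-! ### Privacy by shifting the noise -/

theorem measure_le_of_injective {Ω : Type*} [MeasurableSpace Ω] [Countable Ω]
    [MeasurableSingletonClass Ω] (μ : Measure Ω) {φ : Ω → Ω} (hφ : Function.Injective φ)
    {c : ENNReal} (hc : ∀ x, μ {x} ≤ c * μ {φ x}) {E E' : Set Ω} (hE : ∀ x ∈ E, φ x ∈ E') :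
    μ E ≤ c * μ E' := by
  have h1 : μ E = ∑' x : E, μ {x.1} := by
    rw [← measure_biUnion E.to_countable (fun x _ y _ hxy => by simpa using hxy)
      (fun x _ => measurableSet_singleton x), Set.biUnion_of_singleton]
  have h2 : ∑' x : E, μ {φ x.1} = μ (⋃ x ∈ E, {φ x}) :=
    (measure_biUnion E.to_countable (fun x _ y _ hxy => by simpa using hφ.ne hxy)
      (fun x _ => measurableSet_singleton (φ x))).symm
  calc μ E = ∑' x : E, μ {x.1} := h1
    _ ≤ ∑' x : E, c * μ {φ x.1} := ENNReal.tsum_le_tsum fun x => hc x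
    _ = c * μ (⋃ x ∈ E, {φ x}) := by rw [ENNReal.tsum_mul_left, h2]
    _ ≤ c * μ E' := by
      gcongr
      exact Set.iUnion₂_subset fun x hx => Set.singleton_subset_iff.2 (hE x hx)

section Privacy

variable {V : Type u} [Fintype V]

/-- The law of the noise of one round. -/
noncomputable abbrev roundNoise (V : Type u) [Fintype V] (a : ℝ) (ha : 0 < a) :
    Measure (Option V → ℤ) :=
  Measure.pi fun _ => (geometricNoise a ha).toMeasure

theorem pi_roundNoise_singleton_le {ι : Type*} [Fintype ι] {a : ℝ} (ha : 0 < a)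
    (x y : ι → Option V → ℤ) :
    Measure.pi (fun _ : ι => roundNoise V a ha) {x} ≤
      ENNReal.ofReal (Real.exp (a * ∑ i, ∑ o, ((y i o).natAbs : ℝ))) *
        Measure.pi (fun _ : ι => roundNoise V a ha) {x + y} := by
  have hs : ∀ z : ι → Option V → ℤ, Measure.pi (fun _ : ι => roundNoise V a ha) {z} =
      ∏ i, ∏ o, geometricNoise a ha (z i o) := by
    intro z
    rw [← Set.univ_pi_singleton, Measure.pi_pi]
    refine Finset.prod_congr rfl fun i _ => ?_
    rw [← Set.univ_pi_singleton, Measure.pi_pi]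
    exact Finset.prod_congr rfl fun o _ =>
      PMF.toMeasure_apply_singleton _ _ (measurableSet_singleton _)
  rw [hs, hs, Finset.mul_sum, Real.exp_sum, ENNReal.ofReal_prod_of_nonneg
    (fun _ _ => (Real.exp_pos _).le), ← Finset.prod_mul_distrib]
  refine Finset.prod_le_prod' fun i _ => ?_
  rw [Finset.mul_sum, Real.exp_sum, ENNReal.ofReal_prod_of_nonneg
    (fun _ _ => (Real.exp_pos _).le), ← Finset.prod_mul_distrib]
  exact Finset.prod_le_prod' fun o _ => geometricNoise_le ha _ _

variable {reply : ℕ → V → Set V → (ℕ → V → ℤ) → ℤ → ℤ → ℤ × ℤ} {n : ℕ} {a : ℝ} {ha : 0 < a}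
  {out : (ℕ → V → ℤ) → V → ℝ}

/-- An `integerMechanism` is private if a change of one edge can be compensated, at fixed
messages, by a small change of the noise that depends on the messages only. -/
theorem edgePrivate_integerMechanism (hn : 0 < n) {ε : ℝ} {K : ℕ} (hK : a * K ≤ ε)
    (h : ∀ G G' : SimpleGraph V, Neighboring G G' →
      ∃ σ : (ℕ → V → ℤ) → ℕ → V → ℤ,
        (∀ m, ∑ t ∈ Finset.range n, ∑ v, (σ m t v).natAbs ≤ K) ∧
        ∀ ω : ℕ → V → ℤ, messages reply G' (ω + σ (messages reply G ω n)) n =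
          messages reply G ω n) :
    (integerMechanism n a ha reply out).EdgePrivate ε := by
  intro G G' hG Y _
  obtain ⟨σ, hσK, hσ⟩ := h G G' hG
  let I := Finset.range n
  let ext : (I → Option V → ℤ) → ℕ → V → ℤ :=
    fun x s v => if h : s ∈ I then x ⟨s, h⟩ (some v) else 0
  let Q : Measure (I → Option V → ℤ) := Measure.pi fun _ : I => roundNoise V a ha
  have hext : ∀ (ω : ℕ → Option V → ℤ) {s : ℕ}, s < n → ∀ v,
      ext (I.restrict ω) s v = ω s (some v) := by
    intro ω s hs v
    simp [ext, I, hs]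
  -- The transcript depends on the noise of the first `n` rounds only, so the probabilities can be
  -- computed on a countable space.
  have hlaw : ∀ H : SimpleGraph V, (integerMechanism n a ha reply out).randomnessLaw
      {ω | (integerMechanism n a ha reply out).transcript H ω ∈ Y} =
      Q {x | encodeTranscript n out n (messages reply H (ext x) n) ∈ Y} := by
    intro H
    have hQ : Q = (Measure.infinitePi fun _ : ℕ => roundNoise V a ha).map I.restrict :=
      (Measure.infinitePi_map_restrict (I := I) (fun _ : ℕ => roundNoise V a ha)).symm
    rw [hQ, Measure.map_apply (Finset.measurable_restrict _) (MeasurableSet.of_discrete)]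
    refine congrArg _ (Set.ext fun ω => ?_)
    rw [Set.mem_ofPred_eq, transcript_integerMechanism hn]
    have : simulate reply H (userNoise ω) n = simulate reply H (ext (I.restrict ω)) n :=
      simulate_congr fun s hs => by
        funext v
        exact (hext ω hs v).symm
    rw [messages, this]
    rfl
  rw [hlaw, hlaw]
  -- The noise coordinate `none` of the server is not shifted.
  let sh : (I → Option V → ℤ) → I → Option V → ℤ := fun x i o =>
    o.elim 0 fun v => σ (messages reply G (ext x) n) i v
  have hmsg : ∀ x, messages reply G' (ext (x + sh x)) n = messages reply G (ext x) n := by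
    intro x
    conv_rhs => rw [← hσ (ext x)]
    refine congrArg Prod.fst (simulate_congr fun s hs => ?_)
    funext v
    simp [ext, I, hs, sh]
  refine measure_le_of_injective Q (φ := fun x => x + sh x) ?_ ?_ ?_
  -- The shifted noise determines the messages, these determine the shift, and so the original noise
  -- is recovered.
  · intro x y hxy
    have hm : messages reply G (ext x) n = messages reply G (ext y) n := by
      rw [← hmsg x, ← hmsg y]
      exact congrArg (fun z => messages reply G' (ext z) n) hxy
    have hs : sh x = sh y := by simp only [sh, hm]
    simpa [hs] using hxy
  · intro x
    refine (pi_roundNoise_singleton_le ha x (sh x)).trans ?_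
    gcongr
    refine le_trans (mul_le_mul_of_nonneg_left ?_ ha.le) hK
    have h1 : ∑ i : I, ∑ o, (sh x i o).natAbs ≤ K := by
      refine le_trans (le_of_eq ?_) (hσK (messages reply G (ext x) n))
      refine (Finset.sum_congr rfl fun i _ => ?_).trans (Finset.sum_coe_sort I fun t =>
        ∑ v, (σ (messages reply G (ext x) n) t v).natAbs)
      simp [Fintype.sum_option, sh]
    exact_mod_cast h1
  · intro x hx
    rw [Set.mem_ofPred_eq] at hx ⊢
    rwa [hmsg]

end Privacy

/-! ### Tail bounds for sums of noise -/

section Tail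

variable {V : Type u} [Fintype V]

/-- Chernoff bound: each independent term has exponential moment at most 2 at parameter `a / 2`.
With logarithmically many terms the factor `2 ^ I.card` is only polynomial in `n`. -/
theorem infinitePi_sum_natAbs_gt_le {a : ℝ} (ha : 0 < a) (I : Finset ℕ) (o : Option V) (A : ℝ) :
    Measure.infinitePi (fun _ : ℕ => roundNoise V a ha)
      {ω | A < ∑ s ∈ I, ((ω s o).natAbs : ℝ)} ≤
    2 ^ I.card * ENNReal.ofReal (Real.exp (-(a / 2 * A))) := by
  let f : (Option V → ℤ) → ENNReal := fun x =>
    ENNReal.ofReal (Real.exp (a / 2 * ((x o).natAbs : ℝ)))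
  have hf : Measurable f := by
    have : Measurable (fun z : ℤ => ENNReal.ofReal (Real.exp (a / 2 * (z.natAbs : ℝ)))) :=
      Measurable.of_discrete
    exact this.comp (measurable_pi_apply o)
  let P := Measure.infinitePi (fun _ : ℕ => roundNoise V a ha)
  have hind : ProbabilityTheory.iIndepFun (fun s (ω : ℕ → Option V → ℤ) => f (ω s)) P :=
    ProbabilityTheory.iIndepFun_infinitePi (X := fun _ => f) (fun _ => hf)
  have hone : ∀ s, ∫⁻ ω, f (ω s) ∂P ≤ 2 := by
    intro s
    rw [(measurePreserving_eval_infinitePi (fun _ : ℕ => roundNoise V a ha) s).lintegral_comp hf]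
    have h2 : ∫⁻ x, f x ∂(roundNoise V a ha) = ∫⁻ z : ℤ,
        ENNReal.ofReal (Real.exp (a / 2 * (z.natAbs : ℝ))) ∂(geometricNoise a ha).toMeasure :=
      (measurePreserving_eval (fun _ : Option V => (geometricNoise a ha).toMeasure) o).lintegral_comp
        (f := fun z : ℤ => ENNReal.ofReal (Real.exp (a / 2 * (z.natAbs : ℝ))))
        Measurable.of_discrete
    rw [h2]
    exact lintegral_exp_geometricNoise_le ha
  have hprod : ∫⁻ ω, ∏ s ∈ I, f (ω s) ∂P ≤ 2 ^ I.card := by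
    rw [ProbabilityTheory.lintegral_prod_eq_prod_lintegral_of_indepFun I _ hind
      (fun s => hf.comp (measurable_pi_apply s))]
    exact Finset.prod_le_pow_card _ _ _ fun s _ => hone s
  have hsub : {ω : ℕ → Option V → ℤ | A < ∑ s ∈ I, ((ω s o).natAbs : ℝ)} ⊆
      {ω | ENNReal.ofReal (Real.exp (a / 2 * A)) ≤ ∏ s ∈ I, f (ω s)} := by
    intro ω hω
    rw [Set.mem_ofPred_eq] at hω ⊢
    simp only [f]
    rw [← ENNReal.ofReal_prod_of_nonneg (fun _ _ => (Real.exp_pos _).le), ← Real.exp_sum,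
      ← Finset.mul_sum]
    gcongr
  refine (measure_mono hsub).trans ?_
  refine (meas_ge_le_lintegral_div ?_ ?_ ENNReal.ofReal_ne_top).trans ?_
  · exact (Finset.measurable_prod I fun s _ => hf.comp (measurable_pi_apply s)).aemeasurable
  · simp [Real.exp_pos]
  · rw [Real.exp_neg, ENNReal.ofReal_inv_of_pos (Real.exp_pos _), ← div_eq_mul_inv]
    gcongr

theorem infinitePi_exists_sum_natAbs_gt_le {a : ℝ} (ha : 0 < a) (n l : ℕ) (I : ℕ → Finset ℕ)
    (hI : ∀ t < n, (I t).card ≤ l) (A : ℝ) :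
    Measure.infinitePi (fun _ : ℕ => roundNoise V a ha)
      {ω | ∃ t < n, ∃ v : V, A < ∑ s ∈ I t, ((ω s (some v)).natAbs : ℝ)} ≤
    ENNReal.ofReal (n * Fintype.card V * 2 ^ l * Real.exp (-(a / 2 * A))) := by
  have hset : {ω : ℕ → Option V → ℤ | ∃ t < n, ∃ v : V,
      A < ∑ s ∈ I t, ((ω s (some v)).natAbs : ℝ)} =
      ⋃ t ∈ Finset.range n, ⋃ v ∈ (Finset.univ : Finset V),
        {ω | A < ∑ s ∈ I t, ((ω s (some v)).natAbs : ℝ)} := by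
    ext ω; simp
  have e : ENNReal.ofReal (n * Fintype.card V * 2 ^ l * Real.exp (-(a / 2 * A))) =
      ∑ t ∈ Finset.range n, ∑ v : V, 2 ^ l * ENNReal.ofReal (Real.exp (-(a / 2 * A))) := by
    rw [ENNReal.ofReal_mul (by positivity), ENNReal.ofReal_mul (by positivity),
      ENNReal.ofReal_mul (by positivity), ENNReal.ofReal_pow (by norm_num)]
    simp [mul_assoc]
  rw [hset, e]
  refine (measure_biUnion_finset_le _ _).trans (Finset.sum_le_sum fun t ht => ?_)
  refine (measure_biUnion_finset_le _ _).trans (Finset.sum_le_sum fun v _ => ?_)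
  refine (infinitePi_sum_natAbs_gt_le ha (I t) (some v) A).trans ?_
  gcongr
  · norm_num
  · exact hI t (Finset.mem_range.1 ht)

end Tail

/-! ### Peeling with noisy degrees -/

section Peeling

variable {V : Type u}

/-- The degree within `S` of a vertex with neighborhood `N`. -/
noncomputable def degreeIn (N : Set V) (S : Finset V) : ℕ :=
  (N ∩ S).ncard

theorem le_coreness_of_mem [Finite V] {G : SimpleGraph V} {S : Finset V} {k : ℕ}
    (h : ∀ w ∈ S, k ≤ degreeIn (G.neighborSet w) S) {v : V} (hv : v ∈ S) : k ≤ coreness G v := by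
  refine (coreness_isGreatest G v).2 ⟨(⊤ : G.Subgraph).induce S, hv, fun w hw => ?_⟩
  refine (h w hw).trans (le_of_eq (congrArg Set.ncard ?_))
  ext x
  have hw' : w ∈ S := hw
  simp [hw', and_comm]

variable [Fintype V]

open Classical in
/-- Before round `t`, the set of the remaining vertices and the current level of a peeling process
in which `D t j v` means that `v` is removed in round `t` if the level is `j`. The level rises in
the rounds in which nothing is removed. -/
noncomputable def peel (D : ℕ → ℕ → V → Prop) : ℕ → Finset V × ℕ
  | 0 => (Finset.univ, 0)
  | t + 1 => ((peel D t).1.filter fun v => ¬ D t (peel D t).2 v,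
      if ∃ v ∈ (peel D t).1, D t (peel D t).2 v then (peel D t).2 else (peel D t).2 + 1)

open Classical in
/-- The level at which a vertex was removed in the first `t` rounds, or the current level for the
vertices that remain. -/
noncomputable def peelEstimate (D : ℕ → ℕ → V → Prop) : ℕ → V → ℕ
  | 0, _ => 0
  | t + 1, v => if v ∈ (peel D t).1 then (peel D (t + 1)).2 else peelEstimate D t v

variable {D : ℕ → ℕ → V → Prop}

theorem mem_peel_succ {t : ℕ} {v : V} :
    v ∈ (peel D (t + 1)).1 ↔ v ∈ (peel D t).1 ∧ ¬ D t (peel D t).2 v := by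
  simp [peel]

theorem peel_antitone (D : ℕ → ℕ → V → Prop) : Antitone fun t => (peel D t).1 :=
  antitone_nat_of_succ_le fun _ _ hv => (mem_peel_succ.1 hv).1

theorem peel_congr {D D' : ℕ → ℕ → V → Prop} {t : ℕ} (h : ∀ s < t, D s = D' s) :
    peel D t = peel D' t := by
  induction t with
  | zero => rfl
  | succ t ih =>
    have e := ih fun s hs => h s (by omega)
    simp only [peel]
    rw [e, h t (by omega)]

/-- Every round removes a vertex or raises the level. At `t = Fintype.card V` this bounds the number
of survivors by the level. -/
theorem card_peel_add_le (D : ℕ → ℕ → V → Prop) (t : ℕ) :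
    (peel D t).1.card + t ≤ Fintype.card V + (peel D t).2 := by
  induction t with
  | zero => simp [peel]
  | succ t ih =>
    by_cases h : ∃ v ∈ (peel D t).1, D t (peel D t).2 v
    · have hlt : (peel D (t + 1)).1.card < (peel D t).1.card := by
        obtain ⟨v, hv, hd⟩ := h
        refine Finset.card_lt_card ⟨peel_antitone D (Nat.le_succ t), fun hs => ?_⟩
        exact (mem_peel_succ.1 (hs hv)).2 hd
      have hj : (peel D (t + 1)).2 = (peel D t).2 := by simp only [peel, if_pos h]
      omega
    · have hle : (peel D (t + 1)).1.card ≤ (peel D t).1.card :=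
        Finset.card_le_card (peel_antitone D (Nat.le_succ t))
      have hj : (peel D (t + 1)).2 = (peel D t).2 + 1 := by simp only [peel, if_neg h]
      omega

theorem peel_level_le_succ (D : ℕ → ℕ → V → Prop) (t : ℕ) :
    (peel D t).2 ≤ (peel D (t + 1)).2 := by
  rw [peel]
  dsimp only
  split_ifs <;> omega

variable {G : SimpleGraph V} {n A : ℕ}

theorem peelEstimate_eq_of_mem {t : ℕ} {v : V} (hv : v ∈ (peel D t).1) :
    peelEstimate D t v = (peel D t).2 := by
  cases t with
  | zero => rfl
  | succ t => rw [peelEstimate, if_pos (mem_peel_succ.1 hv).1]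

theorem peelEstimate_le_coreness_add
    (hD : ∀ t < n, ∀ v ∈ (peel D t).1, ¬ D t (peel D t).2 v →
      (peel D t).2 + 1 ≤ degreeIn (G.neighborSet v) (peel D t).1 + A)
    {t : ℕ} (ht : t ≤ n) (v : V) : peelEstimate D t v ≤ coreness G v + A := by
  induction t with
  | zero => simp [peelEstimate]
  | succ t ih =>
    rw [peelEstimate]
    split_ifs with hv
    · by_cases h : ∃ v ∈ (peel D t).1, D t (peel D t).2 v
      · have hj : (peel D (t + 1)).2 = (peel D t).2 := by simp only [peel, if_pos h]
        rw [hj, ← peelEstimate_eq_of_mem hv]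
        exact ih (by omega)
      · have hj : (peel D (t + 1)).2 = (peel D t).2 + 1 := by simp only [peel, if_neg h]
        push Not at h
        -- Truncated subtraction is harmless: if it gives 0, the bound below is trivial.
        have := le_coreness_of_mem (G := G) (S := (peel D t).1) (k := (peel D t).2 + 1 - A)
          (fun w hw => by have := hD t (by omega) w hw (h w hw); omega) hv
        omega
    · exact ih (by omega)

/-- While `H` survives, its vertices have degree at least `k` among the remaining ones, so none is
removed before the level reaches `k - A`. Levels never fall, so later removals also get estimates of
at least `k - A`. -/
theorem subset_peel_or_le
    (hD : ∀ t < n, ∀ v ∈ (peel D t).1, D t (peel D t).2 v →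
      degreeIn (G.neighborSet v) (peel D t).1 ≤ (peel D t).2 + A)
    {H : G.Subgraph} {k : ℕ} (hH : ∀ w ∈ H.verts, k ≤ (H.neighborSet w).ncard)
    {t : ℕ} (ht : t ≤ n) :
    H.verts ⊆ (peel D t).1 ∨ k ≤ (peel D t).2 + A ∧
      ∀ v ∈ H.verts, v ∉ (peel D t).1 → k ≤ peelEstimate D t v + A := by
  induction t with
  | zero => left; simp [peel]
  | succ t ih =>
    have hmono := peel_level_le_succ D t
    by_cases hk : k ≤ (peel D t).2 + A
    · right
      refine ⟨by omega, fun v hv hv' => ?_⟩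
      rw [peelEstimate]
      split_ifs with hvt
      · omega
      · rcases ih (by omega) with h | h
        · exact absurd (h hv) hvt
        · exact h.2 v hv hvt
    · left
      intro v hv
      have hsub := (ih (by omega)).resolve_right fun h => hk h.1
      have hvt : v ∈ (peel D t).1 := hsub hv
      refine mem_peel_succ.2 ⟨hvt, fun hd => hk ?_⟩
      refine ((hH v hv).trans ?_).trans (hD t (by omega) v hvt hd)
      exact Set.ncard_le_ncard
        (fun x hx => ⟨H.adj_sub hx, hsub (H.edge_vert (H.adj_symm hx))⟩) (Set.toFinite _)

theorem coreness_le_peelEstimate_add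
    (hD : ∀ t < Fintype.card V, ∀ v ∈ (peel D t).1, D t (peel D t).2 v →
      degreeIn (G.neighborSet v) (peel D t).1 ≤ (peel D t).2 + A) (v : V) :
    coreness G v ≤ peelEstimate D (Fintype.card V) v + A := by
  obtain ⟨H, hv, hH⟩ := (coreness_isGreatest G v).1
  by_cases hvn : v ∈ (peel D (Fintype.card V)).1
  · rw [peelEstimate_eq_of_mem hvn]
    rcases subset_peel_or_le hD hH le_rfl with h | h
    -- If all of `H` survives the last round, then `k` is at most the number of survivors, hence at
    -- most the final level.
    · have h1 := hH v hv
      have h2 : (H.neighborSet v).ncard ≤ (peel D (Fintype.card V)).1.card := by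
        rw [← Set.ncard_coe_finset]
        exact Set.ncard_le_ncard (fun x hx => h (H.edge_vert (H.adj_symm hx))) (Set.toFinite _)
      have h3 := card_peel_add_le D (Fintype.card V)
      omega
    · exact h.1
  · rcases subset_peel_or_le hD hH le_rfl with h | h
    · exact absurd (h hv) hvn
    · exact h.2 v hv hvn

variable {reply : ℕ → V → Set V → (ℕ → V → ℤ) → ℤ → ℤ → ℤ × ℤ} {a : ℝ} {ha : 0 < a}

/-- If the users of an `integerMechanism` are peeled according to a degree with noise
`∑ s ∈ I t, ω s v`, then the error is bounded by the size of this noise. -/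
theorem estimatesWithin_integerMechanism [Nonempty V] (D : (ℕ → V → ℤ) → ℕ → ℕ → V → Prop)
    {l : ℕ} (I : ℕ → Finset ℕ) (hI : ∀ t < Fintype.card V, (I t).card ≤ l)
    (hdec : ∀ (G : SimpleGraph V) (ω : ℕ → V → ℤ) (m : ℕ → V → ℤ),
      m = messages reply G ω (Fintype.card V) →
      ∀ t < Fintype.card V, ∀ v ∈ (peel (D m) t).1, D m t (peel (D m) t).2 v ↔
        (degreeIn (G.neighborSet v) (peel (D m) t).1 : ℤ) + ∑ s ∈ I t, ω s v ≤
          (peel (D m) t).2)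
    (G : SimpleGraph V) {α : ℝ} (hα : 0 ≤ α) :
    1 - Fintype.card V * Fintype.card V * 2 ^ l * Real.exp (-(a / 2 * α)) ≤
      (integerMechanism (Fintype.card V) a ha reply
        (fun m v => peelEstimate (D m) (Fintype.card V) v)).randomnessLaw.real
      {ω | (integerMechanism (Fintype.card V) a ha reply
        (fun m v => peelEstimate (D m) (Fintype.card V) v)).EstimatesWithin G ω α} := by
  set n := Fintype.card V with hn
  set M := integerMechanism n a ha reply (fun m v => peelEstimate (D m) n v) with hM
  let P : Measure (ℕ → Option V → ℤ) := Measure.infinitePi (fun _ : ℕ => roundNoise V a ha)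
  let bad : Set (ℕ → Option V → ℤ) :=
    {ω | ∃ t < n, ∃ v : V, α < ∑ s ∈ I t, ((ω s (some v)).natAbs : ℝ)}
  have hbad : P.real bad ≤ n * n * 2 ^ l * Real.exp (-(a / 2 * α)) :=
    ENNReal.toReal_le_of_le_ofReal (by positivity)
      (infinitePi_exists_sum_natAbs_gt_le ha n l I hI α)
  have hgood : badᶜ ⊆ {ω | M.EstimatesWithin G ω α} := by
    intro ω hω
    -- The noise is an integer, so `α` can be rounded down and the peeling bounds applied with a
    -- natural number.
    have hω' : ∀ t < n, ∀ v : V, ∑ s ∈ I t, (userNoise ω s v).natAbs ≤ ⌊α⌋₊ := by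
      intro t ht v
      refine Nat.le_floor (le_of_not_gt fun h => hω ⟨t, ht, v, ?_⟩)
      exact_mod_cast h
    set m := messages reply G (userNoise ω) n with hm
    have hnoise : ∀ t < n, ∀ v, |∑ s ∈ I t, userNoise ω s v| ≤ ⌊α⌋₊ := by
      intro t ht v
      refine (Finset.abs_sum_le_sum_abs _ _).trans ?_
      have := hω' t ht v
      simp only [Int.abs_eq_natAbs]
      exact_mod_cast this
    refine ⟨_, returns_integerMechanism Fintype.card_pos ω, fun v => ?_⟩
    have hup : coreness G v ≤ peelEstimate (D m) n v + ⌊α⌋₊ := by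
      refine coreness_le_peelEstimate_add (fun t ht w hw hd => ?_) v
      have h1 := (hdec G _ m hm t ht w hw).1 hd
      have h2 := abs_le.1 (hnoise t ht w)
      omega
    have hlow : peelEstimate (D m) n v ≤ coreness G v + ⌊α⌋₊ := by
      refine peelEstimate_le_coreness_add (n := n) (fun t ht w hw hd => ?_) le_rfl v
      have h1 := mt (hdec G _ m hm t ht w hw).2 hd
      have h2 := abs_le.1 (hnoise t ht w)
      omega
    have hfl := Nat.floor_le hα
    have hup' : (coreness G v : ℝ) ≤ peelEstimate (D m) n v + ⌊α⌋₊ := by exact_mod_cast hup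
    have hlow' : (peelEstimate (D m) n v : ℝ) ≤ coreness G v + ⌊α⌋₊ := by exact_mod_cast hlow
    constructor <;> linarith
  have hP : M.randomnessLaw = P := rfl
  rw [hP]
  have huniv : (1 : ℝ) ≤ P.real bad + P.real badᶜ := by
    have := measureReal_union_le (μ := P) bad badᶜ
    rwa [Set.union_compl_self, probReal_univ] at this
  have hmono : P.real badᶜ ≤ P.real {ω | M.EstimatesWithin G ω α} := measureReal_mono hgood
  exact le_trans (by linarith) hmono

end Peeling

/-! ### Dyadic prefix sums -/

/-- The number `t` with the lowest binary digit `1` removed. -/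
def dyadicParent (t : ℕ) : ℕ :=
  t - 2 ^ padicValNat 2 t

/-- As `o` is even, passing to the parent strictly raises the 2-adic valuation, unless the parent is
0. -/
theorem exists_dyadicParent_eq {t : ℕ} (ht : t ≠ 0) :
    ∃ o, t = 2 ^ padicValNat 2 t * (o + 1) ∧ dyadicParent t = 2 ^ padicValNat 2 t * o ∧
      2 ∣ o := by
  obtain ⟨k, o, ho, rfl⟩ := Nat.exists_eq_two_pow_mul_odd ht
  have hk : padicValNat 2 (2 ^ k * o) = k := by
    rw [padicValNat.mul (by positivity) (by rintro rfl; simp at ho), padicValNat.prime_pow,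
      padicValNat.eq_zero_of_not_dvd ho.not_two_dvd_nat, add_zero]
  obtain ⟨i, rfl⟩ := ho
  refine ⟨2 * i, by rw [hk], ?_, Dvd.intro _ rfl⟩
  rw [dyadicParent, hk, Nat.mul_add, mul_one, Nat.add_sub_cancel]

theorem dyadicParent_lt {t : ℕ} (ht : t ≠ 0) : dyadicParent t < t :=
  Nat.sub_lt (Nat.pos_of_ne_zero ht) (by positivity)

/-- For a fixed valuation the intervals from `dyadicParent t` to `t` are disjoint, so each valuation
below `L` contributes at most one `t`. -/
theorem card_filter_dyadicParent_lt_le {n L : ℕ} (hn : n ≤ 2 ^ L) (f : ℕ) :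
    ((Finset.range n).filter fun t => dyadicParent t < f ∧ f ≤ t).card ≤ L := by
  have h0 : ∀ t, dyadicParent t < f ∧ f ≤ t → t ≠ 0 := by
    rintro _ ⟨h1, h2⟩ rfl
    omega
  conv_rhs => rw [← Finset.card_range L]
  refine Finset.card_le_card_of_injOn (padicValNat 2) ?_ ?_
  · intro t ht
    simp only [Finset.coe_filter, Finset.mem_range, Set.mem_ofPred_eq] at ht
    have h := h0 t ht.2
    rw [Finset.coe_range, Set.mem_Iio]
    refine (Nat.pow_lt_pow_iff_right (a := 2) (by norm_num)).1 ?_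
    exact (Nat.le_of_dvd (Nat.pos_of_ne_zero h) pow_padicValNat_dvd).trans_lt (ht.1.trans_le hn)
  · intro t ht t' ht' hv
    simp only [Finset.coe_filter, Finset.mem_range, Set.mem_ofPred_eq] at ht ht'
    obtain ⟨o, h1, h2, -⟩ := exists_dyadicParent_eq (h0 t ht.2)
    obtain ⟨o', h1', h2', -⟩ := exists_dyadicParent_eq (h0 t' ht'.2)
    rw [← hv] at h1' h2'
    have e1 : o < o' + 1 := Nat.lt_of_mul_lt_mul_left (a := 2 ^ padicValNat 2 t) (by
      rw [← h2, ← h1']; omega)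
    have e2 : o' < o + 1 := Nat.lt_of_mul_lt_mul_left (a := 2 ^ padicValNat 2 t) (by
      rw [← h2', ← h1]; omega)
    obtain rfl : o = o' := by omega
    rw [h1, h1']

/-- The iterated dyadic parents of `t`, including `t` and `0`. -/
def dyadicChain : ℕ → Finset ℕ
  | 0 => {0}
  | t + 1 => insert (t + 1) (dyadicChain (dyadicParent (t + 1)))
decreasing_by exact dyadicParent_lt (Nat.succ_ne_zero t)

theorem dyadicChain_of_ne_zero {t : ℕ} (ht : t ≠ 0) :
    dyadicChain t = insert t (dyadicChain (dyadicParent t)) := by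
  cases t with
  | zero => exact absurd rfl ht
  | succ t => rw [dyadicChain]

theorem le_of_mem_dyadicChain {s t : ℕ} (h : s ∈ dyadicChain t) : s ≤ t := by
  induction t using Nat.strong_induction_on with
  | _ t ih =>
    rcases eq_or_ne t 0 with rfl | ht
    · simpa [dyadicChain] using h
    · rw [dyadicChain_of_ne_zero ht, Finset.mem_insert] at h
      have hp := dyadicParent_lt ht
      rcases h with rfl | h
      · rfl
      · exact (ih _ hp h).trans hp.le

/-- Valuations increase strictly along the chain and stay below `L` until 0 is reached. The
parameter `k` carries the induction; `k = 0` is the case of interest. -/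
theorem card_dyadicChain_add_le {t L : ℕ} (ht : t < 2 ^ L) {k : ℕ} (hk : 2 ^ k ∣ t)
    (hkL : k ≤ L) : (dyadicChain t).card + k ≤ L + 1 := by
  induction t using Nat.strong_induction_on generalizing k with
  | _ t ih =>
    rcases eq_or_ne t 0 with rfl | h0
    · simp [dyadicChain]; omega
    · rw [dyadicChain_of_ne_zero h0]
      have hp := dyadicParent_lt h0
      obtain ⟨o, -, h2, h3⟩ := exists_dyadicParent_eq h0
      have hkv : k ≤ padicValNat 2 t := (padicValNat_dvd_iff_le h0).1 hk
      have hvL : padicValNat 2 t < L := by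
        refine (Nat.pow_lt_pow_iff_right (a := 2) (by norm_num)).1 ?_
        exact (Nat.le_of_dvd (Nat.pos_of_ne_zero h0) pow_padicValNat_dvd).trans_lt ht
      have := ih _ hp (hp.trans ht) (k := padicValNat 2 t + 1)
        (by rw [h2, pow_succ]; exact Nat.mul_dvd_mul_left _ h3) hvL
      have hc := Finset.card_insert_le t (dyadicChain (dyadicParent t))
      omega

theorem sum_dyadicChain (f : ℕ → ℤ) (t : ℕ) :
    ∑ s ∈ dyadicChain t, (f s - if s = 0 then 0 else f (dyadicParent s)) = f t := by
  induction t using Nat.strong_induction_on with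
  | _ t ih =>
    rcases eq_or_ne t 0 with rfl | h0
    · simp [dyadicChain]
    · have hp := dyadicParent_lt h0
      rw [dyadicChain_of_ne_zero h0, Finset.sum_insert
        (fun h => absurd (le_of_mem_dyadicChain h) (by omega)), ih _ hp, if_neg h0]
      ring

/-! ### The effect of one edge -/

section Neighboring

variable {V : Type u}

theorem Neighboring.exists_endpoints [Nonempty V] {G G' : SimpleGraph V} (h : Neighboring G G') :
    ∃ u w : V, ∀ v x, (G.Adj v x ↔ G'.Adj v x) ∨ (v = u ∧ x = w) ∨ (v = w ∧ x = u) := by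
  rcases (symmDiff G.edgeSet G'.edgeSet).eq_empty_or_nonempty with he | ⟨e, he⟩
  · have hG : G = G' := SimpleGraph.edgeSet_injective (symmDiff_eq_bot.1 he)
    exact ⟨Classical.arbitrary V, Classical.arbitrary V, fun v x => Or.inl (by rw [hG])⟩
  · induction e using Sym2.ind with
    | _ u w =>
      refine ⟨u, w, fun v x => ?_⟩
      by_cases hvx : G.Adj v x ↔ G'.Adj v x
      · exact Or.inl hvx
      · right
        have hmem : s(v, x) ∈ symmDiff G.edgeSet G'.edgeSet := by
          rw [Set.mem_symmDiff, SimpleGraph.mem_edgeSet, SimpleGraph.mem_edgeSet]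
          tauto
        exact Sym2.eq_iff.1 (h hmem he)

theorem Neighboring.exists_unaffected [Nonempty V] {G G' : SimpleGraph V}
    (h : Neighboring G G') :
    ∃ U : Finset V, U.card ≤ 2 ∧ ∀ v ∉ U, G.neighborSet v = G'.neighborSet v := by
  classical
  obtain ⟨u, w, huw⟩ := h.exists_endpoints
  refine ⟨{u, w}, Finset.card_le_two, fun v hv => Set.ext fun x => ?_⟩
  simp only [Finset.mem_insert, Finset.mem_singleton, not_or] at hv
  rw [SimpleGraph.mem_neighborSet, SimpleGraph.mem_neighborSet]
  have := huw v x
  tauto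

open Classical in
-- The point is that `δ` does not depend on `S`: the difference between the degrees changes only
-- when `x` leaves the set.
theorem exists_degreeIn_sub_degreeIn_eq [Finite V] {N N' : Set V} {x : V}
    (h : ∀ y ≠ x, y ∈ N ↔ y ∈ N') :
    ∃ δ : ℤ, δ.natAbs ≤ 1 ∧ ∀ S : Finset V,
      (degreeIn N S : ℤ) - degreeIn N' S = if x ∈ S then δ else 0 := by
  have key : ∀ (M : Set V) (S : Finset V), degreeIn M S =
      ((M ∩ S) \ {x}).ncard + if x ∈ M ∧ x ∈ S then 1 else 0 := by
    intro M S
    unfold degreeIn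
    split_ifs with hx
    · exact (Set.ncard_sdiff_singleton_add_one (s := M ∩ S) hx (Set.toFinite _)).symm
    · rw [add_zero, Set.sdiff_singleton_eq_self (s := M ∩ S) hx]
  refine ⟨(if x ∈ N then 1 else 0) - (if x ∈ N' then 1 else 0), by split_ifs <;> simp,
    fun S => ?_⟩
  have e : (N ∩ S) \ {x} = (N' ∩ S) \ {x} := by
    ext y
    by_cases hy : y = x
    · simp [hy]
    · simp [hy, h y hy]
  rw [key N, key N', e]
  by_cases h1 : x ∈ N <;> by_cases h2 : x ∈ N' <;> by_cases h3 : x ∈ S <;> simp [h1, h2, h3]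

open Classical in
theorem Neighboring.exists_degreeIn_sub_eq [Finite V] [Nonempty V] {G G' : SimpleGraph V}
    (h : Neighboring G G') (v : V) :
    ∃ (x : V) (δ : ℤ), δ.natAbs ≤ 1 ∧ ∀ S : Finset V,
      (degreeIn (G.neighborSet v) S : ℤ) - degreeIn (G'.neighborSet v) S =
        if x ∈ S then δ else 0 := by
  obtain ⟨u, w, huw⟩ := h.exists_endpoints
  by_cases hv : v = u
  · refine ⟨w, exists_degreeIn_sub_degreeIn_eq fun y hy => ?_⟩
    rw [SimpleGraph.mem_neighborSet, SimpleGraph.mem_neighborSet]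
    have := huw v y
    grind
  -- For `v = w` the other endpoint is `u`; for any other `v` the neighborhoods agree and every
  -- point would do.
  · refine ⟨u, exists_degreeIn_sub_degreeIn_eq fun y hy => ?_⟩
    rw [SimpleGraph.mem_neighborSet, SimpleGraph.mem_neighborSet]
    have := huw v y
    tauto

end Neighboring

/-! ### Privacy from bounds for single users -/

section UserPrivacy

variable {V : Type u} {reply : ℕ → V → Set V → (ℕ → V → ℤ) → ℤ → ℤ → ℤ × ℤ}
  {n : ℕ} {a : ℝ} {ha : 0 < a} {out : (ℕ → V → ℤ) → V → ℝ}

theorem messages_eq_of_forall_reply_eq {G G' : SimpleGraph V} {ω ω' : ℕ → V → ℤ}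
    (h : ∀ t < n, messages reply G' ω' t = messages reply G ω t → ∀ v,
      (reply t v (G'.neighborSet v) (messages reply G ω t) ((simulate reply G' ω' t).2 v)
        (ω' t v)).1 = messages reply G ω n t v) :
    messages reply G' ω' n = messages reply G ω n := by
  have key : ∀ t ≤ n, messages reply G' ω' t = messages reply G ω t := by
    intro t
    induction t with
    | zero => intro _; rfl
    | succ t ih =>
      intro ht
      have hi := ih (by omega)
      funext s
      rcases lt_trichotomy s t with hs | rfl | hs
      · rw [messages_of_lt hs (Nat.le_succ t), messages_of_lt hs (Nat.le_succ t), hi]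
      · funext v
        rw [messages_apply (Nat.lt_succ_self s), hi, h s (by omega) hi v,
          messages_of_lt (Nat.lt_succ_self s) ht]
      · rw [messages_of_le (by omega), messages_of_le (by omega)]
  exact key n le_rfl

theorem edgePrivate_integerMechanism_of_users [Fintype V] [Nonempty V] (hn : 0 < n) {ε : ℝ}
    {K : ℕ} (hK : a * (2 * K) ≤ ε)
    (h : ∀ G G' : SimpleGraph V, Neighboring G G' →
      ∃ σ : (ℕ → V → ℤ) → ℕ → V → ℤ,
        (∀ m v, G.neighborSet v = G'.neighborSet v → ∀ t, σ m t v = 0) ∧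
        (∀ m v, ∑ t ∈ Finset.range n, (σ m t v).natAbs ≤ K) ∧
        ∀ ω : ℕ → V → ℤ, messages reply G' (ω + σ (messages reply G ω n)) n =
          messages reply G ω n) :
    (integerMechanism n a ha reply out).EdgePrivate ε := by
  refine edgePrivate_integerMechanism hn (K := 2 * K) (by exact_mod_cast hK) fun G G' hG => ?_
  obtain ⟨σ, h1, h2, h3⟩ := h G G' hG
  obtain ⟨U, hU, hU'⟩ := hG.exists_unaffected
  refine ⟨σ, fun m => ?_, h3⟩
  rw [Finset.sum_comm, ← Finset.sum_subset (Finset.subset_univ U) fun v _ hv => by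
    simp [h1 m v (hU' v hv)]]
  refine (Finset.sum_le_card_nsmul U _ K fun v _ => h2 m v).trans ?_
  rw [smul_eq_mul]
  gcongr

end UserPrivacy

variable {V : Type u} [Fintype V]

/-! ### The memoryless mechanism -/

/-- The server removes `v` if the estimate of its degree, a dyadic prefix sum of its messages, is
at most the level. -/
def treeDecision (m : ℕ → V → ℤ) (t j : ℕ) (v : V) : Prop :=
  ∑ s ∈ dyadicChain t, m s v ≤ j

/-- The change of the degree of a vertex between round `dyadicParent t` and round `t`. -/
noncomputable def treeQuery (N : Set V) (m : ℕ → V → ℤ) (t : ℕ) : ℤ :=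
  degreeIn N (peel (treeDecision m) t).1 -
    if t = 0 then 0 else (degreeIn N (peel (treeDecision m) (dyadicParent t)).1 : ℤ)

/-- The users publish `treeQuery` with noise. -/
noncomputable def treeReply (t : ℕ) (_ : V) (N : Set V) (m : ℕ → V → ℤ) (mem γ : ℤ) : ℤ × ℤ :=
  (treeQuery N m t + γ, mem)

/-- Causality: the state before round `t` is a function of earlier messages, so users can compute it
from the transcript. -/
theorem peel_treeDecision_congr {m m' : ℕ → V → ℤ} {t : ℕ} (h : ∀ s < t, m s = m' s) :
    peel (treeDecision m) t = peel (treeDecision m') t := by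
  refine peel_congr fun s hs => ?_
  funext j v
  unfold treeDecision
  rw [Finset.sum_congr rfl fun r hr => by rw [h r ((le_of_mem_dyadicChain hr).trans_lt hs)]]

theorem treeQuery_congr {m m' : ℕ → V → ℤ} {t : ℕ} (h : ∀ s < t, m s = m' s) (N : Set V) :
    treeQuery N m t = treeQuery N m' t := by
  unfold treeQuery
  rw [peel_treeDecision_congr h]
  split_ifs with h0
  · rfl
  · rw [peel_treeDecision_congr fun s hs => h s (hs.trans (dyadicParent_lt h0))]

/-- The increments telescope along the chain to the true current degree, leaving only the noise of
the chain. -/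
theorem treeDecision_messages_iff {G : SimpleGraph V} {ω : ℕ → V → ℤ} {t n : ℕ} (ht : t < n)
    {m : ℕ → V → ℤ} (hm : m = messages treeReply G ω n) (v : V) (j : ℕ) :
    treeDecision m t j v ↔
      (degreeIn (G.neighborSet v) (peel (treeDecision m) t).1 : ℤ) +
        ∑ s ∈ dyadicChain t, ω s v ≤ j := by
  have hs : ∀ s ∈ dyadicChain t, m s v = treeQuery (G.neighborSet v) m s + ω s v := by
    intro s hs
    have hsn := (le_of_mem_dyadicChain hs).trans_lt ht
    rw [hm, messages_apply hsn]
    simp only [treeReply]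
    rw [treeQuery_congr fun r hr => (messages_of_lt hr hsn.le).symm]
  rw [treeDecision, Finset.sum_congr rfl hs, Finset.sum_add_distrib]
  unfold treeQuery
  rw [sum_dyadicChain fun s => (degreeIn (G.neighborSet v) (peel (treeDecision m) s).1 : ℤ)]

theorem sum_natAbs_treeQuery_sub_le [Nonempty V] {G G' : SimpleGraph V} (h : Neighboring G G')
    {n L : ℕ} (hn : n ≤ 2 ^ L) (m : ℕ → V → ℤ) (v : V) :
    ∑ t ∈ Finset.range n,
      (treeQuery (G.neighborSet v) m t - treeQuery (G'.neighborSet v) m t).natAbs ≤ L + 1 := by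
  classical
  obtain ⟨x, δ, hδ, hdeg⟩ := h.exists_degreeIn_sub_eq v
  set S : ℕ → Finset V := fun t => (peel (treeDecision m) t).1 with hS
  have hanti : Antitone S := peel_antitone _
  -- An increment changes only if it is the initial degree or if `x` is removed between the parent
  -- round and round `t`.
  have hterm : ∀ t, (treeQuery (G.neighborSet v) m t -
      treeQuery (G'.neighborSet v) m t).natAbs ≤
        if t = 0 ∨ (x ∈ S (dyadicParent t) ∧ x ∉ S t) then 1 else 0 := by
    intro t
    have h1 := hdeg (S t)
    have h2 := hdeg (S (dyadicParent t))
    simp only [hS] at h1 h2 ⊢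
    unfold treeQuery
    rcases eq_or_ne t 0 with rfl | h0
    · simp only [if_true, true_or]
      split_ifs at h1 <;> omega
    · have hsub : S t ⊆ S (dyadicParent t) := hanti (dyadicParent_lt h0).le
      simp only [h0, if_false, false_or]
      by_cases hx : x ∈ S t
      · have hx' := hsub hx
        simp only [hS] at hx hx'
        simp only [if_pos hx, if_pos hx'] at h1 h2
        simp only [hx, hx', not_true, and_false, if_false]
        omega
      · simp only [hS] at hx
        rw [if_neg hx] at h1
        split_ifs at h2 ⊢ <;> first | omega | tauto
  refine (Finset.sum_le_sum fun t _ => hterm t).trans ?_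
  rw [← Finset.card_filter, Finset.filter_or]
  refine (Finset.card_union_le _ _).trans ?_
  have hzero : ((Finset.range n).filter fun t => t = 0).card ≤ 1 :=
    Finset.card_le_one.2 fun a ha b hb =>
      (Finset.mem_filter.1 ha).2.trans (Finset.mem_filter.1 hb).2.symm
  have hcross : ((Finset.range n).filter fun t =>
      x ∈ S (dyadicParent t) ∧ x ∉ S t).card ≤ L := by
    by_cases hex : ∃ f, x ∉ S f
    · refine (Finset.card_le_card fun t ht => ?_).trans
        (card_filter_dyadicParent_lt_le hn (Nat.find hex))
      rw [Finset.mem_filter] at ht ⊢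
      refine ⟨ht.1, ?_, Nat.find_min' hex ht.2.2⟩
      by_contra hlt
      exact Nat.find_spec hex (hanti (not_lt.1 hlt) ht.2.1)
    · push Not at hex
      simp [hex]
  omega

theorem edgePrivate_treeReply [Nonempty V] {n L : ℕ} (h0 : 0 < n) (hn : n ≤ 2 ^ L) {a ε : ℝ}
    (ha : 0 < a) (hε : a * (2 * (L + 1)) ≤ ε) (out : (ℕ → V → ℤ) → V → ℝ) :
    (integerMechanism n a ha treeReply out).EdgePrivate ε := by
  refine edgePrivate_integerMechanism_of_users h0 (K := L + 1) (by push_cast; exact hε)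
    fun G G' hG => ?_
  refine ⟨fun m t v => treeQuery (G.neighborSet v) m t - treeQuery (G'.neighborSet v) m t,
    fun m v hv t => by simp only [hv, sub_self],
    fun m v => sum_natAbs_treeQuery_sub_le hG hn m v, fun ω => ?_⟩
  refine messages_eq_of_forall_reply_eq fun t ht _ v => ?_
  rw [messages_apply ht]
  simp only [treeReply, Pi.add_apply]
  rw [treeQuery_congr (fun r hr => messages_of_lt hr ht.le) (G.neighborSet v),
    treeQuery_congr (fun r hr => messages_of_lt hr ht.le) (G'.neighborSet v)]
  ring

/-! ### The mechanism with memory -/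

/-- The server removes `v` if its message is `1`. -/
def thresholdDecision (m : ℕ → V → ℤ) (t _ : ℕ) (v : V) : Prop :=
  m t v = 1

open Classical in
/-- The users publish whether they remain and their degree is at most the level. The comparison
has noise of two parts: the noise of round `0`, which is kept in the memory, and fresh noise. -/
noncomputable def thresholdReply (t : ℕ) (v : V) (N : Set V) (m : ℕ → V → ℤ) (mem γ : ℤ) :
    ℤ × ℤ :=
  (if v ∈ (peel (thresholdDecision m) t).1 ∧
      (degreeIn N (peel (thresholdDecision m) t).1 : ℤ) + (mem + γ) ≤
        (peel (thresholdDecision m) t).2 then 1 else 0,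
    if t = 0 then γ else mem)

theorem peel_thresholdDecision_congr {m m' : ℕ → V → ℤ} {t : ℕ} (h : ∀ s < t, m s = m' s) :
    peel (thresholdDecision m) t = peel (thresholdDecision m') t := by
  refine peel_congr fun s hs => ?_
  funext j v
  rw [thresholdDecision, thresholdDecision, h s hs]

theorem memory_thresholdReply {G : SimpleGraph V} {ω : ℕ → V → ℤ} (t : ℕ) (v : V) :
    (simulate thresholdReply G ω t).2 v = if t = 0 then 0 else ω 0 v := by
  induction t with
  | zero => rfl
  | succ t ih =>
    rw [simulate]
    simp only [thresholdReply, ih]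
    rw [if_neg (Nat.succ_ne_zero t)]
    split_ifs with h
    · rw [h]
    · rfl

/-- In round 0 the memory is still 0 and `{0, t}` collapses to one element, so that noise is counted
once. -/
theorem memory_add_thresholdReply {G : SimpleGraph V} {ω : ℕ → V → ℤ} (t : ℕ) (v : V) :
    (simulate thresholdReply G ω t).2 v + ω t v = ∑ s ∈ {0, t}, ω s v := by
  rw [memory_thresholdReply]
  split_ifs with h
  · simp [h]
  · rw [Finset.sum_pair (Ne.symm h)]

theorem thresholdDecision_messages_iff {G : SimpleGraph V} {ω : ℕ → V → ℤ} {t n : ℕ} (ht : t < n)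
    {m : ℕ → V → ℤ} (hm : m = messages thresholdReply G ω n) {v : V}
    (hv : v ∈ (peel (thresholdDecision m) t).1) (j : ℕ) :
    thresholdDecision m t j v ↔
      (degreeIn (G.neighborSet v) (peel (thresholdDecision m) t).1 : ℤ) +
        ∑ s ∈ {0, t}, ω s v ≤ (peel (thresholdDecision m) t).2 := by
  have hp : peel (thresholdDecision (messages thresholdReply G ω t)) t =
      peel (thresholdDecision m) t :=
    peel_thresholdDecision_congr fun r hr => by rw [hm, messages_of_lt hr ht.le]
  have e : m t v = (thresholdReply t v (G.neighborSet v) (messages thresholdReply G ω t)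
      ((simulate thresholdReply G ω t).2 v) (ω t v)).1 := by
    rw [hm, messages_apply ht]
  rw [thresholdDecision, e, ← memory_add_thresholdReply (G := G)]
  simp only [thresholdReply, hp, hv, true_and]
  split_ifs with h <;> simp [h]

open Classical in
/-- The change of the noise of a user that hides a change of its degree by at most `1`. -/
noncomputable def thresholdShift (m : ℕ → V → ℤ) (t : ℕ) (v : V) : ℤ :=
  (if t = 0 then 1 else 0) -
    if v ∈ (peel (thresholdDecision m) t).1 ∧ m t v = 1 then 2 else 0

theorem sum_natAbs_thresholdShift_le (m : ℕ → V → ℤ) (n : ℕ) (v : V) :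
    ∑ t ∈ Finset.range n, (thresholdShift m t v).natAbs ≤ 3 := by
  classical
  have hterm : ∀ t, (thresholdShift m t v).natAbs ≤ (if t = 0 then 1 else 0) +
      2 * if v ∈ (peel (thresholdDecision m) t).1 ∧ m t v = 1 then 1 else 0 := by
    intro t
    unfold thresholdShift
    split_ifs <;> simp
  refine (Finset.sum_le_sum fun t _ => hterm t).trans ?_
  rw [Finset.sum_add_distrib, ← Finset.mul_sum, ← Finset.card_filter, ← Finset.card_filter]
  have h1 : ((Finset.range n).filter fun t => t = 0).card ≤ 1 :=
    Finset.card_le_one.2 fun a ha b hb =>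
      (Finset.mem_filter.1 ha).2.trans (Finset.mem_filter.1 hb).2.symm
  -- Answering 1 removes the user, so this happens at most once while it remains. The total shift is
  -- thus at most `1 + 2`.
  have h2 : ((Finset.range n).filter fun t =>
      v ∈ (peel (thresholdDecision m) t).1 ∧ m t v = 1).card ≤ 1 := by
    have hlt : ∀ s t, (v ∈ (peel (thresholdDecision m) s).1 ∧ m s v = 1) →
        v ∈ (peel (thresholdDecision m) t).1 → ¬ s < t := fun s t hs ht hst =>
      (mem_peel_succ.1 (peel_antitone (thresholdDecision m) (Nat.succ_le_of_lt hst) ht)).2 hs.2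
    refine Finset.card_le_one.2 fun s hs t ht => ?_
    rw [Finset.mem_filter] at hs ht
    have := hlt s t hs.2 ht.2.1
    have := hlt t s ht.2 hs.2.1
    omega
  omega

/-- The net shift is `+1` at an answer 0 and `-1` at an answer 1. A vertex remaining after round 0
did not answer 1 there, so its persistent shift is exactly `+1`. -/
theorem sum_pair_thresholdShift {m : ℕ → V → ℤ} {t : ℕ} {v : V}
    (hv : v ∈ (peel (thresholdDecision m) t).1) :
    ∑ s ∈ {0, t}, thresholdShift m s v = 1 - if m t v = 1 then 2 else 0 := by
  rcases eq_or_ne t 0 with rfl | h0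
  · simp [thresholdShift, hv]
  · have hv0 : m 0 v ≠ 1 := fun h =>
      (mem_peel_succ.1 (peel_antitone (thresholdDecision m) (Nat.one_le_iff_ne_zero.2 h0) hv)).2 h
    rw [Finset.sum_pair (Ne.symm h0)]
    simp [thresholdShift, hv, hv0, h0, sub_eq_add_neg]

open Classical in
theorem edgePrivate_thresholdReply [Nonempty V] {n : ℕ} (h0 : 0 < n) {a ε : ℝ}
    (ha : 0 < a) (hε : a * 6 ≤ ε) (out : (ℕ → V → ℤ) → V → ℝ) :
    (integerMechanism n a ha thresholdReply out).EdgePrivate ε := by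
  refine edgePrivate_integerMechanism_of_users h0 (K := 3) (by norm_num; exact hε)
    fun G G' hG => ?_
  refine ⟨fun m t v => if G.neighborSet v = G'.neighborSet v then 0 else thresholdShift m t v,
    fun m v hv t => if_pos hv, fun m v => ?_, fun ω => ?_⟩
  · by_cases hv : G.neighborSet v = G'.neighborSet v
    · simp [hv]
    · simp only [if_neg hv]
      exact sum_natAbs_thresholdShift_le m n v
  refine messages_eq_of_forall_reply_eq fun t ht _ v => ?_
  set m := messages thresholdReply G ω n with hm
  have hp : peel (thresholdDecision (messages thresholdReply G ω t)) t =
      peel (thresholdDecision m) t :=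
    peel_thresholdDecision_congr fun r hr => (messages_of_lt hr ht.le).symm
  have e : m t v = (thresholdReply t v (G.neighborSet v) (messages thresholdReply G ω t)
      ((simulate thresholdReply G ω t).2 v) (ω t v)).1 := messages_apply ht v
  by_cases hv : v ∈ (peel (thresholdDecision m) t).1
  -- The level `0` is a dummy, as `thresholdDecision` ignores it.
  · have hdec := thresholdDecision_messages_iff ht hm hv 0
    rw [thresholdDecision] at hdec
    simp only [thresholdReply] at e ⊢
    rw [memory_add_thresholdReply, hp]
    rw [memory_add_thresholdReply, hp] at e
    simp only [Pi.add_apply, hv, true_and, Finset.sum_add_distrib] at e ⊢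
    by_cases hN : G.neighborSet v = G'.neighborSet v
    · simp only [if_pos hN, Finset.sum_const_zero, add_zero]
      rw [← hN, e]
    · simp only [if_neg hN]
      rw [sum_pair_thresholdShift hv]
      obtain ⟨x, δ, hδ, hdeg⟩ := hG.exists_degreeIn_sub_eq v
      have hd := hdeg (peel (thresholdDecision m) t).1
      -- The degree changes by at most 1, so a net shift of `+1` keeps the comparison false and `-1`
      -- keeps it true.
      split_ifs at hd e ⊢ <;> omega
  · rw [e]
    simp only [thresholdReply, hp, hv, false_and, if_false]

/-! ### Choice of the constants -/

theorem mul_exp_neg_le_rpow_neg {n k : ℕ} (hn : 2 ≤ n) {B c x : ℝ} (hB : B ≤ (n : ℝ) ^ k)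
    (hx : (c + k) * Real.log n ≤ x) : B * Real.exp (-x) ≤ (n : ℝ) ^ (-c) := by
  have h0 : (0 : ℝ) < n := by exact_mod_cast (show 0 < n by omega)
  calc B * Real.exp (-x) ≤ (n : ℝ) ^ k * Real.exp (-((c + k) * Real.log n)) := by gcongr
    _ = (n : ℝ) ^ (-c) := by
      rw [Real.rpow_def_of_pos h0, ← Real.exp_log (pow_pos h0 k), ← Real.exp_add, Real.log_pow]
      congr 1
      ring

/-- For one vertex `log n = 0` allows no error, but the required probability is 0. -/
theorem one_sub_card_rpow_le {V : Type u} [Fintype V] [Nonempty V] {P : LocalMechanism V}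
    {s : Set P.Randomness} {c : ℝ}
    (h : 2 ≤ Fintype.card V → 1 - (Fintype.card V : ℝ) ^ (-c) ≤ P.randomnessLaw.real s) :
    1 - (Fintype.card V : ℝ) ^ (-c) ≤ P.randomnessLaw.real s := by
  by_cases h2 : 2 ≤ Fintype.card V
  · exact h h2
  · have h1 : Fintype.card V = 1 := by
      have := Fintype.card_pos (α := V)
      omega
    rw [h1, Nat.cast_one, Real.one_rpow, sub_self]
    exact measureReal_nonneg

theorem exists_memoryless_coreness_mechanism (V : Type u) [Fintype V] [Nonempty V] {ε : ℝ}
    (hε : 0 < ε) :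
    ∃ M : LocalMechanism V,
      M.Memoryless ∧ M.EdgePrivate ε ∧ M.RoundsAtMost (Fintype.card V) ∧
      ∀ c : ℝ, 0 < c → ∀ G : SimpleGraph V,
        1 - (Fintype.card V : ℝ) ^ (-c) ≤ M.randomnessLaw.real {ω | M.EstimatesWithin G ω
          (20 * (c + 5) * ε⁻¹ * Real.log (Fintype.card V) ^ 2)} := by
  let n := Fintype.card V
  let L := Nat.log 2 n + 1
  have hn0 : 0 < n := Fintype.card_pos
  have hnL : n < 2 ^ L := Nat.lt_pow_succ_log_self (by norm_num) n
  have ha : 0 < ε / (2 * (L + 1)) := by positivity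
  refine ⟨integerMechanism n (ε / (2 * (L + 1))) ha treeReply
    (fun m v => peelEstimate (treeDecision m) n v), fun t v N τ m γ => rfl,
    edgePrivate_treeReply hn0 hnL.le ha (le_of_eq (by field_simp)) _,
    roundsAtMost_integerMechanism hn0, fun c hc G => one_sub_card_rpow_le fun hn2 => ?_⟩
  refine le_trans ?_ (estimatesWithin_integerMechanism treeDecision (l := L + 1) dyadicChain
    (fun t ht => card_dyadicChain_add_le (ht.trans hnL) (one_dvd _) (Nat.zero_le L))
    (fun G ω m hm t ht v _ => treeDecision_messages_iff ht hm v _) G (by positivity))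
  refine sub_le_sub_left (mul_exp_neg_le_rpow_neg (k := 5) hn2 ?_ ?_) 1
  -- `k = 5` collects two factors `n` from the union bound and three from `2 ^ (L + 1) = 4 * 2 ^
  -- Nat.log 2 n`.
  · have h1 : 2 ^ (L + 1) ≤ n * n * n := by
      have h2 : 2 ^ Nat.log 2 n ≤ n := Nat.pow_log_le_self 2 hn0.ne'
      calc 2 ^ (L + 1) = 2 * 2 * 2 ^ Nat.log 2 n := by simp only [L]; ring
        _ ≤ n * n * n := by gcongr
    have h2 : n * n * 2 ^ (L + 1) ≤ n ^ 5 := by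
      calc n * n * 2 ^ (L + 1) ≤ n * n * (n * n * n) := by gcongr
        _ = n ^ 5 := by ring
    exact_mod_cast h2
  · have hlog2 : (0.6 : ℝ) ≤ Real.log 2 := by linarith [Real.log_two_gt_d9]
    have hlogn : Real.log 2 ≤ Real.log n :=
      Real.log_le_log (by norm_num) (by exact_mod_cast hn2)
    -- `L + 1 = Nat.log 2 n + 2`, and both `log 2` and `log n` are at least `0.6 = 3 / 5`.
    have hL : ((L : ℝ) + 1) ≤ 5 * Real.log n := by
      have h2 : (2 : ℝ) ^ Nat.log 2 n ≤ n := by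
        exact_mod_cast Nat.pow_log_le_self 2 hn0.ne'
      have h3 := Real.log_le_log (by positivity) h2
      rw [Real.log_pow] at h3
      have h4 : (L : ℝ) = Nat.log 2 n + 1 := by simp [L]
      have h5 : (0 : ℝ) ≤ Nat.log 2 n := Nat.cast_nonneg _
      nlinarith
    have e : ε / (2 * ((L : ℝ) + 1)) / 2 * (20 * (c + 5) * ε⁻¹ * Real.log n ^ 2) =
        (c + 5) * Real.log n * (5 * Real.log n / (L + 1)) := by
      field_simp
      ring
    have h6 : 1 ≤ 5 * Real.log n / (L + 1) := (one_le_div (by positivity)).2 hL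
    refine le_trans ?_ (le_of_eq e.symm)
    refine le_mul_of_one_le_right ?_ h6
    have : 0 ≤ Real.log n := by linarith
    push_cast
    positivity

theorem exists_coreness_mechanism (V : Type u) [Fintype V] [Nonempty V] {ε : ℝ} (hε : 0 < ε) :
    ∃ M : LocalMechanism V,
      M.EdgePrivate ε ∧ M.RoundsAtMost (Fintype.card V) ∧
      ∀ c : ℝ, 0 < c → ∀ (G : SimpleGraph V) (x : ℝ), 2 ≤ x →
        1 - (Fintype.card V : ℝ) ^ (-c) ≤ M.randomnessLaw.real {ω | M.EstimatesWithin G ω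
          (20 * (c + 4) * ε⁻¹ * Real.log (Fintype.card V) * Real.log x)} := by
  let n := Fintype.card V
  have hn0 : 0 < n := Fintype.card_pos
  have ha : 0 < ε / 6 := by positivity
  refine ⟨integerMechanism n (ε / 6) ha thresholdReply
    (fun m v => peelEstimate (thresholdDecision m) n v),
    edgePrivate_thresholdReply hn0 ha (le_of_eq (by ring)) _,
    roundsAtMost_integerMechanism hn0, fun c hc G x hx => one_sub_card_rpow_le fun hn2 => ?_⟩
  have hlog2 : (0.6 : ℝ) ≤ Real.log 2 := by linarith [Real.log_two_gt_d9]
  have hlogx : Real.log 2 ≤ Real.log x := Real.log_le_log (by norm_num) hx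
  have hlogn : 0 ≤ Real.log n := Real.log_natCast_nonneg n
  have hlogx0 : 0 ≤ Real.log x := by linarith
  refine le_trans ?_ (estimatesWithin_integerMechanism thresholdDecision (l := 2)
    (fun t => {0, t}) (fun t _ => Finset.card_le_two)
    (fun G ω m hm t ht v hv => thresholdDecision_messages_iff ht hm hv _) G (by positivity))
  refine sub_le_sub_left (mul_exp_neg_le_rpow_neg (k := 4) hn2 ?_ ?_) 1
  · have h2 : n * n * 2 ^ 2 ≤ n ^ 4 := by
      calc n * n * 2 ^ 2 ≤ n * n * n ^ 2 := by gcongr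
        _ = n ^ 4 := by ring
    exact_mod_cast h2
  -- The factor `log x` is used only through `5 / 3 * log x ≥ 1`, and the mechanism does not depend
  -- on `x`; hence `Δ` need not be known.
  · have e : ε / 6 / 2 * (20 * (c + 4) * ε⁻¹ * Real.log n * Real.log x) =
        (c + 4) * Real.log n * (5 / 3 * Real.log x) := by
      field_simp
      ring
    refine le_trans ?_ (le_of_eq e.symm)
    refine le_mul_of_one_le_right ?_ (by linarith)
    push_cast
    positivity

end LocalDP

theorem theorem3p1 :
    -- memoryless mechanism, error `O(ε⁻¹ log² n)`
    (∃ C : ℝ → ℝ,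
      ∀ (V : Type u) [Fintype V] [Nonempty V] (ε : ℝ), 0 < ε →
        ∃ M : LocalDP.LocalMechanism V,
          M.Memoryless ∧ M.EdgePrivate ε ∧ M.RoundsAtMost (Fintype.card V) ∧
          ∀ (c : ℝ), 0 < c → ∀ G : SimpleGraph V,
            1 - (Fintype.card V : ℝ) ^ (-c) ≤
              M.randomnessLaw.real {ω | M.EstimatesWithin G ω
                (C c * ε⁻¹ * Real.log (Fintype.card V) ^ 2)}) ∧
    -- mechanism with memory, error `O(ε⁻¹ log n log Δ)`
    (∃ C : ℝ → ℝ,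
      ∀ (V : Type u) [Fintype V] [Nonempty V] (ε : ℝ), 0 < ε →
        ∃ M : LocalDP.LocalMechanism V,
          M.EdgePrivate ε ∧ M.RoundsAtMost (Fintype.card V) ∧
          ∀ (c : ℝ), 0 < c → ∀ (G : SimpleGraph V) [DecidableRel G.Adj],
            1 - (Fintype.card V : ℝ) ^ (-c) ≤
              M.randomnessLaw.real {ω | M.EstimatesWithin G ω
                (C c * ε⁻¹ * Real.log (Fintype.card V) *
                  Real.log (max (G.maxDegree : ℝ) 2))}) := by
  refine ⟨⟨fun c => 20 * (c + 5), fun V _ _ ε hε =>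
    LocalDP.exists_memoryless_coreness_mechanism V hε⟩, ⟨fun c => 20 * (c + 4),
    fun V _ _ ε hε => ?_⟩⟩
  obtain ⟨M, h1, h2, h3⟩ := LocalDP.exists_coreness_mechanism V hε
  exact ⟨M, h1, h2, fun c hc G _ => h3 c hc G _ (le_max_right _ _)⟩
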